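/- For complex numbers $a,q$ and an integer $n\ge 0$ let $(a;q)_n=\prod_{k=0}^{n-1}(1-aq^k)$, and for $|q|<1$ let $(a;q)_\infty=\prod_{k=0}^{\infty}(1-aq^k)$ and $(a_1,\dots,a_m;q)_\infty=(a_1;q)_\infty\cdots(a_m;q)_\infty$. Then for all $q\in\mathbb{C}$ with $|q|<1$ and all $z\in\mathbb{C}\setminus\{0\}$, the following series converges (absolutely) and $$\sum_{n=0}^{\infty}\frac{(q/z;q)_{n+1}\,(z;q)_n\,q^{n^2+n}}{(q;q)_{2n+1}}=\frac{(q^2z,\;q/z,\;q^3;\;q^3)_\infty}{(q;q)_\infty}.$$ -/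

import Mathlib

/-- The finite `q`-shifted factorial `(a;q)_n = (1-a)(1-aq)⋯(1-aq^{n-1})`. -/
noncomputable def qPoch (a q : ℂ) (n : ℕ) : ℂ :=
  ∏ k ∈ Finset.range n, (1 - a * q ^ k)

/-- The infinite `q`-shifted factorial `(a;q)_∞ = (1-a)(1-aq)(1-aq^2)⋯`. -/
noncomputable def qPochInf (a q : ℂ) : ℂ :=
  ∏' k : ℕ, (1 - a * q ^ k)

/-- The infinite product defining `(a;q)_∞` converges for `|q| < 1`, so that `qPochInf a q`
is its genuine value. -/
theorem multipliable_qPochInf (a q : ℂ) (hq : ‖q‖ < 1) :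
    Multipliable (fun k : ℕ => 1 - a * q ^ k) := by
  have h : Summable (fun k : ℕ => ‖-(a * q ^ k)‖) := by
    simpa [norm_mul, norm_pow] using
      (summable_geometric_of_lt_one (norm_nonneg q) hq).mul_left ‖a‖
  simpa [sub_eq_add_neg] using multipliable_one_add_of_summable h

/-! Put `x = q / z`. The finite triple product expands `(x;q)_{n+1} (q/x;q)_n / (q;q)_{2n+1}` as a
sum over `k ∈ ℤ` of `(-x)^k q^{k(k-1)/2} / ((q;q)_{n+k} (q;q)_{n+1-k})`. After multiplying by
`q^{n²+n}` and interchanging the sums, Cauchy's identity evaluates the sum over `n` as `q^{k(k-1)} /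
(q;q)_∞`. The exponents add up to `3k(k-1)/2`, which leaves a theta series in base `q^3`, and
Jacobi's triple product sums it. The pillars are `hasSum_finite_triple_product`,
`hasSum_triple_product`, `hasSum_durfeeTerm` and `summable_doubleTerm`. -/

open Filter Topology

/-! ### The reciprocal of `(q;q)_i`, extended by zero to negative indices -/

theorem qPoch_succ (a q : ℂ) (n : ℕ) : qPoch a q (n + 1) = qPoch a q n * (1 - a * q ^ n) :=
  Finset.prod_range_succ _ _

theorem one_sub_pow_succ_ne_zero {q : ℂ} (hq : ‖q‖ < 1) (n : ℕ) : 1 - q ^ (n + 1) ≠ 0 := by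
  intro h
  have h1 : ‖q ^ (n + 1)‖ = 1 := by rw [← sub_eq_zero.1 h]; simp
  rw [norm_pow] at h1
  exact (pow_lt_one₀ (norm_nonneg q) hq n.succ_ne_zero).ne h1

theorem qPoch_self_ne_zero {q : ℂ} (hq : ‖q‖ < 1) (n : ℕ) : qPoch q q n ≠ 0 :=
  Finset.prod_ne_zero_iff.2 fun k _ => by
    rw [← pow_succ']; exact one_sub_pow_succ_ne_zero hq k

theorem qPochInf_self_ne_zero {q : ℂ} (hq : ‖q‖ < 1) : qPochInf q q ≠ 0 := by
  have h := tprod_one_add_ne_zero_of_summable (f := fun k : ℕ => -(q * q ^ k))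
    (fun k => by
      rw [← sub_eq_add_neg, ← pow_succ']; exact one_sub_pow_succ_ne_zero hq k)
    (by
      simpa [norm_mul, norm_pow] using
        (summable_geometric_of_lt_one (norm_nonneg q) hq).mul_left ‖q‖)
  simpa [qPochInf, sub_eq_add_neg] using h

theorem tendsto_qPoch (a : ℂ) {q : ℂ} (hq : ‖q‖ < 1) :
    Tendsto (qPoch a q) atTop (𝓝 (qPochInf a q)) :=
  (multipliable_qPochInf a q hq).tendsto_prod_tprod_nat

/-- `1 / (q;q)_i` for `i ≥ 0`, and `0` for `i < 0`. -/
noncomputable def qRecip (q : ℂ) (i : ℤ) : ℂ :=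
  if i < 0 then 0 else (qPoch q q i.toNat)⁻¹

theorem qRecip_natCast (q : ℂ) (n : ℕ) : qRecip q n = (qPoch q q n)⁻¹ := by
  simp [qRecip]

theorem qRecip_of_neg (q : ℂ) {i : ℤ} (hi : i < 0) : qRecip q i = 0 := if_pos hi

/-- The factor `1 - q^0 = 0` makes extension by zero consistent at `i = 0`, so later recurrences
need no boundary cases. -/
theorem qRecip_sub_one {q : ℂ} (hq : ‖q‖ < 1) (i : ℤ) :
    qRecip q (i - 1) = (1 - q ^ i) * qRecip q i := by
  rcases lt_trichotomy i 0 with hi | rfl | hi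
  · rw [qRecip_of_neg q hi, qRecip_of_neg q (by omega), mul_zero]
  · rw [qRecip_of_neg q (by omega)]; simp
  · obtain ⟨n, rfl⟩ : ∃ n : ℕ, i = (n : ℤ) + 1 := ⟨(i - 1).toNat, by omega⟩
    have h : qRecip q ((n : ℤ) + 1) = (qPoch q q (n + 1))⁻¹ := by
      exact_mod_cast qRecip_natCast q (n + 1)
    have h' : q ^ ((n : ℤ) + 1) = q ^ (n + 1) := by exact_mod_cast zpow_natCast q (n + 1)
    rw [add_sub_cancel_right, qRecip_natCast, h, h', qPoch_succ, ← pow_succ']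
    have h0 := one_sub_pow_succ_ne_zero hq n
    have h1 := qPoch_self_ne_zero hq n
    field_simp

theorem tendsto_qRecip {q : ℂ} (hq : ‖q‖ < 1) :
    Tendsto (qRecip q) atTop (𝓝 (qPochInf q q)⁻¹) := by
  have htop : Tendsto Int.toNat atTop atTop :=
    tendsto_atTop.2 fun n => (eventually_ge_atTop (n : ℤ)).mono fun i hi => by omega
  have h := ((tendsto_qPoch q hq).inv₀ (qPochInf_self_ne_zero hq)).comp htop
  refine h.congr' ?_
  filter_upwards [eventually_ge_atTop 0] with i hi
  simp [qRecip, not_lt.2 hi]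

theorem exists_norm_qRecip_le {q : ℂ} (hq : ‖q‖ < 1) :
    ∃ B : ℝ, 0 ≤ B ∧ ∀ i, ‖qRecip q i‖ ≤ B := by
  have h := (tendsto_qPoch q hq).inv₀ (qPochInf_self_ne_zero hq)
  obtain ⟨B, hB⟩ := (Metric.isBounded_range_of_tendsto _ h).exists_norm_le
  have hB' : ∀ n, ‖(qPoch q q n)⁻¹‖ ≤ B := fun n => hB _ ⟨n, rfl⟩
  have h0 : 0 ≤ B := (norm_nonneg _).trans (hB' 0)
  refine ⟨B, h0, fun i => ?_⟩
  unfold qRecip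
  split_ifs
  · simpa using h0
  · exact hB' _

/-! ### The triple product identity -/

/-- The general term `(-x)^k q^{k(k-1)/2}` of the bilateral theta series. -/
noncomputable def thetaTerm (x q : ℂ) (k : ℤ) : ℂ :=
  (-x) ^ k * q ^ (k * (k - 1) / 2)

theorem thetaTerm_add_one {x q : ℂ} (hx : x ≠ 0) (hq0 : q ≠ 0) (k : ℤ) :
    thetaTerm x q (k + 1) = -x * q ^ k * thetaTerm x q k := by
  have h : (k + 1) * (k + 1 - 1) / 2 = k * (k - 1) / 2 + k := by
    rw [show (k + 1) * (k + 1 - 1) = k * (k - 1) + k * 2 by ring,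
      Int.add_mul_ediv_right _ _ two_ne_zero]
  rw [thetaTerm, thetaTerm, h, zpow_add₀ hq0, zpow_add_one₀ (neg_ne_zero.2 hx)]
  ring

theorem thetaTerm_ne_zero {x q : ℂ} (hx : x ≠ 0) (hq0 : q ≠ 0) (k : ℤ) :
    thetaTerm x q k ≠ 0 :=
  mul_ne_zero (zpow_ne_zero _ (neg_ne_zero.2 hx)) (zpow_ne_zero _ hq0)

theorem thetaTerm_mul_zpow {x q : ℂ} (hq0 : q ≠ 0) (k : ℤ) :
    thetaTerm x q k * q ^ (k * (k - 1)) = thetaTerm x (q ^ 3) k := by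
  have h : k * (k - 1) = 2 * (k * (k - 1) / 2) :=
    (Int.mul_ediv_cancel' (Int.even_mul_pred_self k).two_dvd).symm
  have h3 : (q ^ 3) ^ (k * (k - 1) / 2) = q ^ (3 * (k * (k - 1) / 2)) := by
    rw [zpow_mul]; norm_cast
  rw [thetaTerm, thetaTerm, h3, mul_assoc, ← zpow_add₀ hq0]
  congr 2
  omega

theorem summable_norm_thetaTerm {x q : ℂ} (hx : x ≠ 0) (hq0 : q ≠ 0) (hq : ‖q‖ < 1) :
    Summable fun k : ℤ => ‖thetaTerm x q k‖ := by
  have hpow := tendsto_pow_atTop_nhds_zero_of_lt_one (norm_nonneg q) hq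
  refine Summable.of_nat_of_neg ?_ ?_
  · refine summable_of_ratio_test_tendsto_lt_one (l := 0) zero_lt_one
      (Eventually.of_forall fun k => norm_ne_zero_iff.2 (thetaTerm_ne_zero hx hq0 _)) ?_
    have h : Tendsto (fun k : ℕ => ‖x‖ * ‖q‖ ^ k) atTop (𝓝 0) := by
      simpa using hpow.const_mul ‖x‖
    refine h.congr fun k => ?_
    have h0 := norm_ne_zero_iff.2 (thetaTerm_ne_zero hx hq0 (k : ℤ))
    push_cast
    rw [thetaTerm_add_one hx hq0, norm_norm, norm_norm, norm_mul _ (thetaTerm x q k),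
      mul_div_cancel_right₀ _ h0]
    simp
  · refine summable_of_ratio_test_tendsto_lt_one (l := 0) zero_lt_one
      (Eventually.of_forall fun k => norm_ne_zero_iff.2 (thetaTerm_ne_zero hx hq0 _)) ?_
    have h : Tendsto (fun k : ℕ => ‖x‖⁻¹ * ‖q‖ ^ (k + 1)) atTop (𝓝 0) := by
      simpa using ((tendsto_add_atTop_iff_nat 1).2 hpow).const_mul ‖x‖⁻¹
    refine h.congr fun k => ?_
    have h0 := norm_ne_zero_iff.2 (thetaTerm_ne_zero hx hq0 (-((k + 1 : ℕ) : ℤ)))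
    have hk : -(k : ℤ) = -((k + 1 : ℕ) : ℤ) + 1 := by push_cast; ring
    have hx' := norm_ne_zero_iff.2 hx
    have hq' := norm_ne_zero_iff.2 hq0
    rw [hk, thetaTerm_add_one hx hq0, norm_norm, norm_norm, norm_mul, norm_mul, norm_neg,
      zpow_neg, norm_inv, zpow_natCast, norm_pow]
    field_simp

/-- Raising the number of factors `1 - x q^i` by one. -/
theorem thetaTerm_recurrence_left {x q : ℂ} (hx : x ≠ 0) (hq0 : q ≠ 0) (hq : ‖q‖ < 1)
    (m n k : ℤ) :
    (1 - q ^ (m + n + 1)) * (thetaTerm x q (k + 1) * qRecip q (n + (k + 1))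
        * qRecip q (m + 1 - (k + 1))) =
      thetaTerm x q (k + 1) * qRecip q (n + (k + 1)) * qRecip q (m - (k + 1))
        - x * q ^ m * (thetaTerm x q k * qRecip q (n + k) * qRecip q (m - k)) := by
  have h1 := qRecip_sub_one hq (n + (k + 1))
  have h2 := qRecip_sub_one hq (m - k)
  rw [show n + (k + 1) - 1 = n + k by ring] at h1
  -- With `A = q^(m-k)` and `B = q^(n+k+1)`, the claim reduces to `1 - AB = (1 - A) + A(1 - B)`.
  rw [show m - (k + 1) = m - k - 1 by ring, show m + 1 - (k + 1) = m - k by ring, h1, h2,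
    thetaTerm_add_one hx hq0,
    show q ^ m = q ^ (m - k) * q ^ k by rw [← zpow_add₀ hq0]; congr 1; ring,
    show q ^ (m + n + 1) = q ^ (m - k) * q ^ (n + (k + 1)) by
      rw [← zpow_add₀ hq0]; congr 1; ring]
  ring

/-- Raising the number of factors `1 - q^{i+1} / x` by one. -/
theorem thetaTerm_recurrence_right {x q : ℂ} (hx : x ≠ 0) (hq0 : q ≠ 0) (hq : ‖q‖ < 1)
    (m n k : ℤ) :
    (1 - q ^ (m + n + 1)) * (thetaTerm x q k * qRecip q (n + 1 + k) * qRecip q (m - k)) =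
      thetaTerm x q k * qRecip q (n + k) * qRecip q (m - k)
        - q / x * q ^ n *
          (thetaTerm x q (k + 1) * qRecip q (n + (k + 1)) * qRecip q (m - (k + 1))) := by
  have h1 := qRecip_sub_one hq (n + 1 + k)
  have h2 := qRecip_sub_one hq (m - k)
  rw [show n + 1 + k - 1 = n + k by ring] at h1
  rw [show m - (k + 1) = m - k - 1 by ring, show n + (k + 1) = n + 1 + k by ring, h1, h2,
    thetaTerm_add_one hx hq0,
    show q ^ (m + n + 1) = q ^ (m - k) * q ^ (n + 1 + k) by
      rw [← zpow_add₀ hq0]; congr 1; ring,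
    show q ^ (n + 1 + k) = q * q ^ n * q ^ k by
      rw [zpow_add₀ hq0, zpow_add_one₀ hq0]; ring]
  field_simp
  ring

/-- The finite form of the triple product identity. -/
theorem hasSum_finite_triple_product {x q : ℂ} (hx : x ≠ 0) (hq0 : q ≠ 0) (hq : ‖q‖ < 1)
    (m n : ℕ) :
    HasSum (fun k : ℤ => thetaTerm x q k * qRecip q (n + k) * qRecip q (m - k))
      (qPoch x q m * qPoch (q / x) q n / qPoch q q (m + n)) := by
  induction m with
  | zero =>
    induction n with
    | zero =>
      have h := hasSum_single
        (f := fun k : ℤ => thetaTerm x q k * qRecip q ((0 : ℕ) + k) * qRecip q ((0 : ℕ) - k)) 0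
        (fun k hk => by
          rcases lt_or_gt_of_ne hk with hk | hk
          · rw [qRecip_of_neg q (i := (0 : ℕ) + k) (by simpa using hk)]; simp
          · rw [qRecip_of_neg q (i := (0 : ℕ) - k) (by simpa using hk)]; simp)
      simpa [thetaTerm, qRecip, qPoch] using h
    | succ n ih =>
      have hne := one_sub_pow_succ_ne_zero hq n
      have h1 := ih.sub (((Equiv.addRight (1 : ℤ)).hasSum_iff.2 ih).mul_left (q / x * q ^ n))
      have h2 := h1.mul_left (1 - q ^ (n + 1))⁻¹
      have hv : qPoch x q 0 * qPoch (q / x) q (n + 1) / qPoch q q (0 + (n + 1)) =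
          (1 - q ^ (n + 1))⁻¹ * (qPoch x q 0 * qPoch (q / x) q n / qPoch q q (0 + n) -
            q / x * q ^ n * (qPoch x q 0 * qPoch (q / x) q n / qPoch q q (0 + n))) := by
        have h0 := qPoch_self_ne_zero hq n
        simp only [zero_add]
        rw [qPoch_succ, qPoch_succ, ← pow_succ']
        field_simp
      rw [hv]
      refine h2.congr_fun fun k => ?_
      have h := thetaTerm_recurrence_right hx hq0 hq 0 n k
      rw [show (0 : ℤ) + n + 1 = ((n + 1 : ℕ) : ℤ) by push_cast; ring, zpow_natCast,
        zpow_natCast] at h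
      rw [eq_inv_mul_iff_mul_eq₀ hne]
      push_cast
      simpa using h
  | succ m ih =>
    have hne := one_sub_pow_succ_ne_zero hq (m + n)
    rw [← (Equiv.addRight (1 : ℤ)).hasSum_iff]
    have h1 := ((Equiv.addRight (1 : ℤ)).hasSum_iff.2 ih).sub (ih.mul_left (x * q ^ m))
    have h2 := h1.mul_left (1 - q ^ (m + n + 1))⁻¹
    have hv : qPoch x q (m + 1) * qPoch (q / x) q n / qPoch q q (m + 1 + n) =
        (1 - q ^ (m + n + 1))⁻¹ * (qPoch x q m * qPoch (q / x) q n / qPoch q q (m + n) -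
          x * q ^ m * (qPoch x q m * qPoch (q / x) q n / qPoch q q (m + n))) := by
      have h0 := qPoch_self_ne_zero hq (m + n)
      rw [show m + 1 + n = m + n + 1 by ring, qPoch_succ, qPoch_succ q, ← pow_succ']
      field_simp
    rw [hv]
    refine h2.congr_fun fun k => ?_
    have h := thetaTerm_recurrence_left hx hq0 hq m n k
    rw [show (m : ℤ) + n + 1 = ((m + n + 1 : ℕ) : ℤ) by push_cast; ring, zpow_natCast,
      zpow_natCast] at h
    rw [eq_inv_mul_iff_mul_eq₀ hne]
    push_cast
    simpa using h

/-- The Jacobi triple product identity. -/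
theorem hasSum_triple_product {x q : ℂ} (hx : x ≠ 0) (hq0 : q ≠ 0) (hq : ‖q‖ < 1) :
    HasSum (thetaTerm x q) (qPochInf x q * qPochInf (q / x) q * qPochInf q q) := by
  obtain ⟨B, hB0, hB⟩ := exists_norm_qRecip_le hq
  have hinf := qPochInf_self_ne_zero hq
  have hS := summable_norm_thetaTerm hx hq0 hq
  -- Take `m = n → ∞` in the finite form; the uniform bound `B` on `qRecip` gives a dominating
  -- series.
  have hlim : Tendsto (fun n : ℕ => ∑' k : ℤ,
      thetaTerm x q k * qRecip q (n + k) * qRecip q (n - k)) atTop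
      (𝓝 (∑' k : ℤ, thetaTerm x q k * (qPochInf q q)⁻¹ * (qPochInf q q)⁻¹)) := by
    refine tendsto_tsum_of_dominated_convergence (bound := fun k => ‖thetaTerm x q k‖ * B * B)
      ((hS.mul_right B).mul_right B) (fun k => ?_) (Eventually.of_forall fun n k => ?_)
    · refine Tendsto.mul (Tendsto.mul tendsto_const_nhds ?_) ?_
      · exact (tendsto_qRecip hq).comp
          (tendsto_atTop_add_const_right _ k tendsto_natCast_atTop_atTop)
      · exact (tendsto_qRecip hq).comp
          (tendsto_atTop_add_const_right _ (-k) tendsto_natCast_atTop_atTop)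
    · rw [norm_mul, norm_mul]
      gcongr <;> exact hB _
  have hlim' : Tendsto (fun n : ℕ => qPoch x q n * qPoch (q / x) q n / qPoch q q (n + n)) atTop
      (𝓝 (qPochInf x q * qPochInf (q / x) q / qPochInf q q)) :=
    ((tendsto_qPoch x hq).mul (tendsto_qPoch (q / x) hq)).div
      ((tendsto_qPoch q hq).comp (tendsto_id.atTop_add_atTop tendsto_id)) hinf
  have heq := tendsto_nhds_unique
    (hlim.congr fun n => (hasSum_finite_triple_product hx hq0 hq n n).tsum_eq) hlim'
  rw [tsum_mul_right, tsum_mul_right] at heq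
  have hval : ∑' k, thetaTerm x q k = qPochInf x q * qPochInf (q / x) q * qPochInf q q := by
    field_simp at heq
    rw [heq]
    ring
  rw [← hval]
  exact hS.of_norm.hasSum

/-! ### Cauchy's identity -/

theorem summable_pow_sq {r : ℝ} (h0 : 0 ≤ r) (h1 : r < 1) :
    Summable fun j : ℕ => r ^ (j ^ 2) :=
  (summable_geometric_of_lt_one h0 h1).of_nonneg_of_le (fun _ => by positivity)
    fun j => pow_le_pow_of_le_one h0 h1.le (Nat.le_self_pow two_ne_zero j)

/-- The general term of the Durfee rectangle series. -/
noncomputable def durfeeTerm (q : ℂ) (m j : ℕ) : ℂ :=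
  q ^ (j ^ 2 + m * j) * qRecip q j * qRecip q (j + m)

theorem norm_durfeeTerm_le {q : ℂ} (hq : ‖q‖ < 1) {B : ℝ} (hB0 : 0 ≤ B)
    (hB : ∀ i, ‖qRecip q i‖ ≤ B) (m j : ℕ) :
    ‖durfeeTerm q m j‖ ≤ ‖q‖ ^ (j ^ 2) * B * B := by
  rw [durfeeTerm, norm_mul, norm_mul, norm_pow]
  gcongr ?_ * ?_ * ?_
  · exact pow_le_pow_of_le_one (norm_nonneg q) hq.le (Nat.le_add_right _ _)
  · exact hB _
  · exact hB _

theorem summable_durfeeTerm {q : ℂ} (hq : ‖q‖ < 1) (m : ℕ) : Summable (durfeeTerm q m) := by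
  obtain ⟨B, hB0, hB⟩ := exists_norm_qRecip_le hq
  exact Summable.of_norm_bounded
    (((summable_pow_sq (norm_nonneg q) hq).mul_right B).mul_right B)
    (norm_durfeeTerm_le hq hB0 hB m)

/-- Since `|q^(m+1)| ≤ 1`, consecutive differences of the sums do not decrease in norm as `m` grows.
They tend to zero, so they all vanish and the sum is independent of `m`. -/
theorem tsum_durfeeTerm_recurrence {q : ℂ} (hq : ‖q‖ < 1) (m : ℕ) :
    ∑' j, durfeeTerm q m j - ∑' j, durfeeTerm q (m + 1) j =
      q ^ (m + 1) * (∑' j, durfeeTerm q (m + 2) j - ∑' j, durfeeTerm q (m + 1) j) := by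
  set u : ℕ → ℂ := fun j => q ^ (j ^ 2 + m * j) * qRecip q ((j : ℤ) - 1) * qRecip q (j + m + 1)
    with hu
  have hu1 : ∀ j, u (j + 1) = q ^ (m + 1) * durfeeTerm q (m + 2) j := by
    intro j
    simp only [hu, durfeeTerm]
    push_cast
    rw [show (j : ℤ) + 1 - 1 = j by ring, show (j : ℤ) + 1 + m + 1 = j + (m + 2) by ring]
    ring
  have hu0 : u 0 = 0 := by simp [hu, qRecip]
  have husum : Summable u := by
    rw [← summable_nat_add_iff 1]
    simpa only [hu1] using (summable_durfeeTerm hq (m + 2)).mul_left _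
  have hdiff : ∀ j, durfeeTerm q m j - durfeeTerm q (m + 1) j =
      u j - q ^ (m + 1) * durfeeTerm q (m + 1) j := by
    intro j
    have h1 := qRecip_sub_one hq j
    have h2 := qRecip_sub_one hq ((j + m + 1 : ℕ) : ℤ)
    rw [zpow_natCast] at h1 h2
    push_cast at h2
    rw [add_sub_cancel_right] at h2
    simp only [hu, durfeeTerm]
    push_cast
    rw [h1, h2, ← add_assoc (j : ℤ) m 1]
    ring
  rw [← (summable_durfeeTerm hq m).tsum_sub (summable_durfeeTerm hq (m + 1)),
    tsum_congr hdiff, husum.tsum_sub ((summable_durfeeTerm hq (m + 1)).mul_left _),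
    husum.tsum_eq_zero_add, hu0, zero_add, tsum_congr hu1, tsum_mul_left, tsum_mul_left]
  ring

/-- The factor `q^(mj)` kills every term but `j = 0` in the limit. -/
theorem tendsto_tsum_durfeeTerm {q : ℂ} (hq : ‖q‖ < 1) :
    Tendsto (fun m => ∑' j, durfeeTerm q m j) atTop (𝓝 (qPochInf q q)⁻¹) := by
  obtain ⟨B, hB0, hB⟩ := exists_norm_qRecip_le hq
  have h : Tendsto (fun m => ∑' j, durfeeTerm q m j) atTop
      (𝓝 (∑' j : ℕ, if j = 0 then (qPochInf q q)⁻¹ else 0)) := by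
    refine tendsto_tsum_of_dominated_convergence
      (((summable_pow_sq (norm_nonneg q) hq).mul_right B).mul_right B) (fun j => ?_)
      (Eventually.of_forall fun m j => norm_durfeeTerm_le hq hB0 hB m j)
    have hr : Tendsto (fun m : ℕ => qRecip q (j + m)) atTop (𝓝 (qPochInf q q)⁻¹) :=
      (tendsto_qRecip hq).comp
        (tendsto_atTop_add_const_left _ (j : ℤ) tendsto_natCast_atTop_atTop)
    rcases Nat.eq_zero_or_pos j with rfl | hj
    · refine hr.congr fun m => ?_
      simp [durfeeTerm, qRecip, qPoch]
    · have hp : Tendsto (fun m : ℕ => q ^ (j ^ 2) * (q ^ j) ^ m * qRecip q j) atTop (𝓝 0) := by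
        have := tendsto_pow_atTop_nhds_zero_of_norm_lt_one (x := q ^ j)
          (by rw [norm_pow]; exact pow_lt_one₀ (norm_nonneg q) hq hj.ne')
        simpa using (this.const_mul (q ^ (j ^ 2))).mul_const (qRecip q j)
      rw [if_neg hj.ne']
      have := hp.mul hr
      rw [zero_mul] at this
      refine this.congr fun m => ?_
      rw [durfeeTerm, pow_add, mul_comm m j, pow_mul q j m]
  simpa using h

theorem eq_zero_of_tendsto_of_norm_le_succ {D : ℕ → ℂ} (hD : Tendsto D atTop (𝓝 0))
    (h : ∀ m, ‖D m‖ ≤ ‖D (m + 1)‖) (m : ℕ) : D m = 0 := by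
  have hmono : Monotone fun m => ‖D m‖ := monotone_nat_of_le_succ h
  have := hmono.ge_of_tendsto (by simpa using hD.norm) m
  exact norm_le_zero_iff.1 this

/-- Cauchy's identity `∑ q^{j²+mj} / ((q;q)_j (q;q)_{j+m}) = 1 / (q;q)_∞`. -/
theorem hasSum_durfeeTerm {q : ℂ} (hq : ‖q‖ < 1) (m : ℕ) :
    HasSum (durfeeTerm q m) (qPochInf q q)⁻¹ := by
  set F : ℕ → ℂ := fun m => ∑' j, durfeeTerm q m j with hF
  have hlim : Tendsto F atTop (𝓝 (qPochInf q q)⁻¹) := tendsto_tsum_durfeeTerm hq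
  have hD : Tendsto (fun m => F m - F (m + 1)) atTop (𝓝 0) := by
    simpa using hlim.sub ((tendsto_add_atTop_iff_nat 1).2 hlim)
  have hstep : ∀ m, F m = F (m + 1) := fun m => sub_eq_zero.1 <|
    eq_zero_of_tendsto_of_norm_le_succ hD (fun m => by
      rw [show F m - F (m + 1) = q ^ (m + 1) * (F (m + 2) - F (m + 1)) from
        tsum_durfeeTerm_recurrence hq m, norm_mul, norm_pow, norm_sub_rev]
      exact mul_le_of_le_one_left (norm_nonneg _) (pow_le_one₀ (norm_nonneg q) hq.le)) m
  have hconst : ∀ n, F (n + m) = F m := by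
    intro n
    induction n with
    | zero => rw [zero_add]
    | succ n ih => rw [← ih, Nat.add_right_comm, ← hstep]
  have hval : F m = (qPochInf q q)⁻¹ := by
    refine tendsto_nhds_unique (tendsto_const_nhds.congr fun n => (hconst n).symm)
      (hlim.comp (tendsto_add_atTop_nat m))
  rw [← hval]
  exact (summable_durfeeTerm hq m).hasSum

/-! ### The main identity -/

/-- Terms with `n < l` vanish; for `n = j + l`, `n² + n = l(l+1) + j² + (2l+1)j`, which is Cauchy's
identity with `m = 2l + 1`. -/
theorem hasSum_qRecip_mul_qRecip_succ {q : ℂ} (hq : ‖q‖ < 1) (l : ℕ) :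
    HasSum (fun n : ℕ => q ^ (n ^ 2 + n) * (qRecip q (n + (l + 1)) * qRecip q (n - l)))
      (q ^ (l * (l + 1)) * (qPochInf q q)⁻¹) := by
  refine ((add_left_injective l).hasSum_iff fun n hn => ?_).1
    (((hasSum_durfeeTerm hq (2 * l + 1)).mul_left (q ^ (l * (l + 1)))).congr_fun fun j => ?_)
  · have hnl : n < l := by
      by_contra h
      exact hn ⟨n - l, by simp; omega⟩
    rw [qRecip_of_neg q (i := n - l) (by omega)]
    simp
  · simp only [Function.comp, durfeeTerm]
    push_cast
    rw [add_sub_cancel_right, show (j : ℤ) + l + (l + 1) = j + (2 * l + 1) by ring]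
    ring

/-- The symmetry `k ↔ 1 - k` swaps the two reciprocals, so `k = -l` and `k = l + 1` give the same
sum. -/
theorem hasSum_qRecip_mul_qRecip {q : ℂ} (hq : ‖q‖ < 1) (k : ℤ) :
    HasSum (fun n : ℕ => q ^ (n ^ 2 + n) * (qRecip q (n + k) * qRecip q (n + 1 - k)))
      (q ^ (k * (k - 1)) * (qPochInf q q)⁻¹) := by
  rcases le_or_gt k 0 with hk | hk
  · obtain ⟨l, rfl⟩ : ∃ l : ℕ, k = -l := ⟨(-k).toNat, by omega⟩
    have h := hasSum_qRecip_mul_qRecip_succ hq l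
    rw [show -(l : ℤ) * (-l - 1) = ((l * (l + 1) : ℕ) : ℤ) by push_cast; ring, zpow_natCast]
    refine h.congr_fun fun n => ?_
    rw [mul_comm (qRecip q _), ← sub_eq_add_neg, sub_neg_eq_add, add_right_comm, add_assoc]
  · obtain ⟨l, rfl⟩ : ∃ l : ℕ, k = l + 1 := ⟨(k - 1).toNat, by omega⟩
    have h := hasSum_qRecip_mul_qRecip_succ hq l
    rw [show ((l : ℤ) + 1) * (l + 1 - 1) = ((l * (l + 1) : ℕ) : ℤ) by push_cast; ring,
      zpow_natCast]
    refine h.congr_fun fun n => ?_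
    rw [add_sub_add_right_eq_sub]

theorem HasSum.of_summable_prod_of_hasSum_comm {α β : Type*} {f : α × β → ℂ} {g : α → ℂ}
    {h : β → ℂ} {s : ℂ} (hf : Summable f) (hrow : ∀ a, HasSum (fun b => f (a, b)) (g a))
    (hcol : ∀ b, HasSum (fun a => f (a, b)) (h b)) (hs : HasSum h s) : HasSum g s := by
  have h2 : HasSum h (∑' p, f p) :=
    ((Equiv.prodComm β α).hasSum_iff.2 hf.hasSum).prod_fiberwise hcol
  rw [hs.unique h2]
  exact hf.hasSum.prod_fiberwise hrow

/-- The summand of the double series obtained by expanding each term of the main series. -/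
noncomputable def doubleTerm (x q : ℂ) (p : ℕ × ℤ) : ℂ :=
  q ^ (p.1 ^ 2 + p.1) *
    (thetaTerm x q p.2 * qRecip q (p.1 + p.2) * qRecip q ((p.1 + 1 : ℕ) - p.2))

/-- Bounding both reciprocals by `B` decouples the indices: the majorant is a product of a series in
`n` and a theta series in `k`. -/
theorem summable_doubleTerm {x q : ℂ} (hx : x ≠ 0) (hq0 : q ≠ 0) (hq : ‖q‖ < 1) :
    Summable (doubleTerm x q) := by
  obtain ⟨B, hB0, hB⟩ := exists_norm_qRecip_le hq
  have hb := ((summable_pow_sq (norm_nonneg q) hq).mul_of_nonneg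
    (summable_norm_thetaTerm hx hq0 hq) (fun _ => by positivity)
    (fun _ => norm_nonneg _)).mul_right (B * B)
  refine Summable.of_norm_bounded hb fun p => ?_
  have hp : ‖q‖ ^ (p.1 ^ 2 + p.1) ≤ ‖q‖ ^ (p.1 ^ 2) :=
    pow_le_pow_of_le_one (norm_nonneg q) hq.le (Nat.le_add_right _ _)
  rw [doubleTerm, norm_mul, norm_mul, norm_mul, norm_pow, mul_assoc ‖thetaTerm x q p.2‖,
    ← mul_assoc]
  exact mul_le_mul (mul_le_mul_of_nonneg_right hp (norm_nonneg _))
    (mul_le_mul (hB _) (hB _) (norm_nonneg _) hB0) (by positivity) (by positivity)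

theorem hasSum_doubleTerm_row {x q : ℂ} (hx : x ≠ 0) (hq0 : q ≠ 0) (hq : ‖q‖ < 1) (n : ℕ) :
    HasSum (fun k => doubleTerm x q (n, k)) (q ^ (n ^ 2 + n) *
      (qPoch x q (n + 1) * qPoch (q / x) q n / qPoch q q (n + 1 + n))) := by
  simp only [doubleTerm]
  exact (hasSum_finite_triple_product hx hq0 hq (n + 1) n).mul_left (q ^ (n ^ 2 + n))

theorem hasSum_doubleTerm_col {x q : ℂ} (hq0 : q ≠ 0) (hq : ‖q‖ < 1) (k : ℤ) :
    HasSum (fun n => doubleTerm x q (n, k)) (thetaTerm x (q ^ 3) k * (qPochInf q q)⁻¹) := by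
  rw [← thetaTerm_mul_zpow hq0, mul_assoc]
  refine ((hasSum_qRecip_mul_qRecip hq k).mul_left (thetaTerm x q k)).congr_fun fun n => ?_
  rw [doubleTerm, mul_assoc (thetaTerm x q k), mul_left_comm, Nat.cast_add_one]

theorem hasSum_of_ne_zero {x q : ℂ} (hx : x ≠ 0) (hq0 : q ≠ 0) (hq : ‖q‖ < 1) :
    HasSum (fun n : ℕ => q ^ (n ^ 2 + n) *
        (qPoch x q (n + 1) * qPoch (q / x) q n / qPoch q q (n + 1 + n)))
      (qPochInf x (q ^ 3) * qPochInf (q ^ 3 / x) (q ^ 3) * qPochInf (q ^ 3) (q ^ 3)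
        * (qPochInf q q)⁻¹) := by
  have hq3 : ‖q ^ 3‖ < 1 := by
    rw [norm_pow]; exact pow_lt_one₀ (norm_nonneg q) hq three_ne_zero
  have hfs := summable_doubleTerm hx hq0 hq
  exact HasSum.of_summable_prod_of_hasSum_comm hfs (hasSum_doubleTerm_row hx hq0 hq)
    (hasSum_doubleTerm_col hq0 hq)
    ((hasSum_triple_product hx (pow_ne_zero 3 hq0) hq3).mul_right (qPochInf q q)⁻¹)

theorem theorem3p3 (q z : ℂ) (hq : ‖q‖ < 1) (hz : z ≠ 0) :
    HasSum
      (fun n : ℕ =>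
        qPoch (q / z) q (n + 1) * qPoch z q n * q ^ (n ^ 2 + n) / qPoch q q (2 * n + 1))
      (qPochInf (q ^ 2 * z) (q ^ 3) * qPochInf (q / z) (q ^ 3) * qPochInf (q ^ 3) (q ^ 3) /
        qPochInf q q) := by
  -- The expansion uses negative powers of `q`; at `q = 0` only the term `n = 0` survives.
  rcases eq_or_ne q 0 with rfl | hq0
  · have h := hasSum_single (f := fun n : ℕ => qPoch (0 / z) 0 (n + 1) * qPoch z 0 n *
      (0 : ℂ) ^ (n ^ 2 + n) / qPoch 0 0 (2 * n + 1)) 0 (fun n hn => by simp [hn])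
    simpa [qPoch, qPochInf] using h
  · have h := hasSum_of_ne_zero (div_ne_zero hq0 hz) hq0 hq
    have h1 : q / (q / z) = z := by field_simp
    have h3 : q ^ 3 / (q / z) = q ^ 2 * z := by field_simp
    rw [h1, h3] at h
    rw [div_eq_mul_inv _ (qPochInf q q), mul_comm (qPochInf (q ^ 2 * z) _)]
    refine h.congr_fun fun n => ?_
    rw [show n + 1 + n = 2 * n + 1 by omega, mul_div_assoc', mul_comm (q ^ (n ^ 2 + n))]
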